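/- **Setting.** A primary transmitter (PT) with $N\ge 1$ antennas sends a signal $x_0$ through one of $K\ge1$ full-duplex secondary transmitters (STs) to the primary receiver (PR), which is served by NOMA together with $M$ secondary receivers. All channel coefficients are independent and Rayleigh: every entry of the PT–ST$_k$ channel $\mathbf h_{k}\in\mathbb C^N$ has exponential squared modulus with mean $\lambda_{ps}>0$, and the $M+1$ (unsorted) channels from the selected ST to the receivers have exponential squared moduli with mean $\lambda_{sp}>0$. The selected ST $b$ maximizes $\|\mathbf h_k\|^2$; write $X=\|\mathbf h_b\|^2$. PR is the receiver with the smallest of the $M+1$ gains; write $Y$ for that smallest gain. Let $\bar\gamma>0$ be the transmit SNR, $0<\beta<1$, $0<\eta\le1$, $0<\xi\le1$, $0<\psi<1$, let $I_{SI}\ge 0$ be the self-interference gain with $\eta\beta\xi\psi I_{SI}<1$, let $\bar R_0>0$ be the target rate and let $\alpha_0\ge\dots\ge\alpha_M\ge0$ satisfy $\sum_{i=0}^M\alpha_i=1$. Put $$\rho=\frac{\eta\beta\xi\psi}{1-\eta\beta\xi\psi I_{SI}},\quad \gamma_0=2^{\bar R_0}-1,\quad \mu=\frac{\gamma_0}{(1-\beta)(1-\gamma_0\rho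 I_{SI})},\quad \Theta_0=\frac{\gamma_0}{\rho\,(\alpha_0-\gamma_0\sum_{i=1}^M\alpha_i)} .$$ The rates for decoding $x_0$ at the selected ST and at PR are $$R_s=\log_2\Big(1+\tfrac{(1-\beta)\bar\gamma X}{(1-\beta)\rho\bar\gamma I_{SI}X+1}\Big),\qquad R_p=\log_2\Big(1+\tfrac{\alpha_0\rho\bar\gamma XY}{\sum_{i=1}^M\alpha_i\,\rho\bar\gamma XY+1}\Big),$$ and the outage probability of the primary network is $P_p=\Phi_1+\Phi_2$ with $\Phi_1=\Pr(R_s<\bar R_0)$ and $\Phi_2=\Pr(R_s\ge\bar R_0,\ R_p<\bar R_0)$. For $0\le l\le K$ and $0\le j\le l(N-1)$ let $C_0=1$, $C_1=l$ and $C_j=\frac1j\sum_{r=1}^{\min(j,N-1)}\frac{rl-j+r}{r!}C_{j-r}$ for $j\ge2$ (so $C_j$ depends on $l$ and $N$). Let $$F(x)=\sum_{l=0}^K\binom Kl(-1)^le^{-lx/\lambda_{ps}}\sum_{j=0}^{l(N-1)}\frac{C_jx^j}{\lambda_{ps}^j},\qquad f(x)=\sum_{l=1}^K\binom Kl(-1)^le^{-lx/\lambda_{ps}}\sum_{j=0}^{l(N-1)}\frac{C_j}{\lambda_{ps}^j}\Big(jx^{j-1}-\frac{l}{\lambda_{ps}}x^j\Big).$$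 With $q=1$, $Q=M+1$, $\iota_q=\frac{Q!}{(q-1)!(Q-q)!}$ and a function $\varphi$ on $[0,\infty)$ let $$J[\varphi]=\int_{\mu/\bar\gamma}^\infty \iota_q\sum_{c=0}^{Q-q}\sum_{n=0}^{q+c}\binom{Q-q}{c}\binom{q+c}{n}\frac{(-1)^{c+n}}{q+c}\,\varphi\Big(\frac{n\Theta_0}{\lambda_{sp}\bar\gamma x}\Big)f(x)\,dx .$$ Finally, with $\Gamma(s,x)=\int_x^\infty t^{s-1}e^{-t}\,dt$ and $z_l=\frac{l\mu}{\lambda_{ps}\bar\gamma}$, let $$S=\iota_q\sum_{c=0}^{Q-q}\sum_{n=0}^{q+c}\sum_{l=1}^K\sum_{j=0}^{l(N-1)}\binom{Q-q}{c}\binom{q+c}{n}\binom Kl\frac{(-1)^{c+n+l}}{q+c}\frac{C_j}{l^j}\Big[\Big(j+\tfrac{n\Theta_0l}{\lambda_{sp}\lambda_{ps}\bar\gamma}\Big)\Gamma(j,z_l)-\Gamma(j+1,z_l)-\tfrac{n\Theta_0jl}{\lambda_{sp}\lambda_{ps}\bar\gamma}\Gamma(j-1,z_l)\Big].$$ **Theorem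 1.** Suppose $\gamma_0<\min\big\{\frac1{\rho I_{SI}},\ \frac{\alpha_0}{\sum_{i=1}^M\alpha_i}\big\}$ (a quotient with denominator $0$ being read as $+\infty$). Then the outage probability is approximated by $$P_p\approx F(\mu/\bar\gamma)+S$$ in the following precise sense. 1. The first term is exact: $\Phi_1=\Pr(X\le\mu/\bar\gamma)=F(\mu/\bar\gamma)$. 2. The second term is exactly the conditioning integral, $\Phi_2=J[t\mapsto e^{-t}]$ (with integrable integrand), and replacing $e^{-t}$ by $1-t$ in this integral, i.e. $e^{-a/x}$ by $1-a/x$, gives exactly $J[t\mapsto 1-t]=S$ (again with integrable integrand). 3. The resulting error satisfies $$0\le F(\mu/\bar\gamma)+S-P_p\le\frac12\Big(\frac{(M+1)\Theta_0}{\lambda_{sp}\bar\gamma}\Big)^2\,\mathbb E\big[X^{-2}\mathbf 1_{\{X\ge\mu/\bar\gamma\}}\big].$$ If the condition on $\gamma_0$ fails, then $P_p=1$. -/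

import Mathlib

noncomputable section

namespace CoopNOMA

/-- Parameters of the network: `N` antennas at the primary transmitter (PT), `K` secondary
transmitters (ST), `M` secondary receivers (SR); mean channel gains `lamPS` (each antenna of PT to
each ST) and `lamSP` (best ST to a receiver, before sorting); transmit SNR `snr`; power splitting
fraction `beta`; energy conversion efficiency `eta`; amplifier portion `xi`; energy utilization
efficiency `psi`; self-interference gain `ISI`; target rate `R0` of the primary signal; power
allocation coefficients `alpha` (index `0` is the primary receiver (PR), index `m` is the
`m`-th SR). -/
structure Params where
  N : ℕ
  K : ℕ
  M : ℕ
  lamPS : ℝ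
  lamSP : ℝ
  snr : ℝ
  beta : ℝ
  eta : ℝ
  xi : ℝ
  psi : ℝ
  ISI : ℝ
  R0 : ℝ
  alpha : Fin (M + 1) → ℝ

namespace Params

variable (p : Params)

/-- The admissible range of the parameters. The last field says that the harvested power balance
`P_sb = eta * beta * xi * psi * (P_s * ‖h‖ ^ 2 + P_sb * ISI)` has a positive solution `P_sb`. -/
structure Valid : Prop where
  one_le_N : 1 ≤ p.N
  one_le_K : 1 ≤ p.K
  lamPS_pos : 0 < p.lamPS
  lamSP_pos : 0 < p.lamSP
  snr_pos : 0 < p.snr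
  beta_pos : 0 < p.beta
  beta_lt_one : p.beta < 1
  eta_pos : 0 < p.eta
  eta_le_one : p.eta ≤ 1
  xi_pos : 0 < p.xi
  xi_le_one : p.xi ≤ 1
  psi_pos : 0 < p.psi
  psi_lt_one : p.psi < 1
  ISI_nonneg : 0 ≤ p.ISI
  R0_pos : 0 < p.R0
  alpha_nonneg : ∀ i, 0 ≤ p.alpha i
  alpha_antitone : Antitone p.alpha
  alpha_sum : ∑ i, p.alpha i = 1
  harvest_lt_one : p.eta * p.beta * p.xi * p.psi * p.ISI < 1

/-- `ρ`: the transmit power of the best ST is `ρ * P_s * ‖h‖ ^ 2`. -/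
def rho : ℝ :=
  p.eta * p.beta * p.xi * p.psi / (1 - p.eta * p.beta * p.xi * p.psi * p.ISI)

/-- `γ₀ = 2 ^ R₀ - 1`. -/
def gamma0 : ℝ := 2 ^ p.R0 - 1

/-- `∑_{i=1}^M α_i`. -/
def alphaSec : ℝ := ∑ i : Fin p.M, p.alpha i.succ

/-- `μ`. -/
def mu : ℝ := p.gamma0 / ((1 - p.beta) * (1 - p.gamma0 * p.rho * p.ISI))

/-- `Θ₀`. -/
def theta0 : ℝ := p.gamma0 / (p.rho * (p.alpha 0 - p.alphaSec * p.gamma0))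

/-- `γ₀ < min (1 / (ρ * ISI)) (α₀ / ∑_{i=1}^M α_i)`, with denominators cleared, so that a
vanishing denominator imposes no constraint. -/
def Feasible : Prop :=
  p.gamma0 * (p.rho * p.ISI) < 1 ∧ p.gamma0 * p.alphaSec < p.alpha 0

end Params

section Model

variable {Ω : Type*} [MeasurableSpace Ω]

/-- A Rayleigh fading coefficient with mean gain `lam`: the squared modulus is exponentially
distributed with mean `lam` (equivalently, the modulus is Rayleigh distributed). -/
def IsRayleigh (P : MeasureTheory.Measure Ω) (X : Ω → ℂ) (lam : ℝ) : Prop :=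
  Measurable X ∧ P.map (fun ω => ‖X ω‖ ^ 2) = ProbabilityTheory.expMeasure (1 / lam)

/-- Joint law of all channel coefficients. `h k n` is the channel from antenna `n` of PT to the
`k`-th ST; `g i` are the unsorted channels from the best ST to the `M + 1` receivers. All are
independent and Rayleigh. -/
structure IsChannelModel (p : Params) (P : MeasureTheory.Measure Ω)
    (h : Fin p.K → Fin p.N → Ω → ℂ) (g : Fin (p.M + 1) → Ω → ℂ) : Prop where
  rayleigh_h : ∀ k n, IsRayleigh P (h k n) p.lamPS
  rayleigh_g : ∀ i, IsRayleigh P (g i) p.lamSP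
  indep : ProbabilityTheory.iIndepFun
    (Sum.elim (fun kn : Fin p.K × Fin p.N => h kn.1 kn.2) g) P

end Model

section Rates

variable {Ω : Type*} (p : Params) (h : Fin p.K → Fin p.N → Ω → ℂ) (g : Fin (p.M + 1) → Ω → ℂ)
  (b : Ω → Fin p.K)

/-- `‖h_{ps_k}‖ ^ 2`, the gain from PT to the `k`-th ST. -/
def gainST (k : Fin p.K) (ω : Ω) : ℝ := ∑ n, ‖h k n ω‖ ^ 2

/-- `b` selects an ST with the largest gain from PT. -/
def IsBestST : Prop := ∀ ω k, gainST p h k ω ≤ gainST p h (b ω) ω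

/-- `‖h_{ps_b}‖ ^ 2`, the gain from PT to the selected ST. -/
def bestGain (ω : Ω) : ℝ := gainST p h (b ω) ω

/-- `|h_{s_b p}| ^ 2`: PR is the receiver with the smallest gain from the selected ST. -/
def priGain (ω : Ω) : ℝ := Finset.univ.inf' Finset.univ_nonempty fun i => ‖g i ω‖ ^ 2

/-- Achievable rate at the selected ST for decoding the primary signal. -/
def rateST (ω : Ω) : ℝ :=
  Real.logb 2 (1 + (1 - p.beta) * p.snr * bestGain p h b ω /
    ((1 - p.beta) * p.rho * p.snr * p.ISI * bestGain p h b ω + 1))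

/-- Achievable rate at PR for decoding the primary signal when the selected ST forwards it. -/
def ratePR (ω : Ω) : ℝ :=
  Real.logb 2 (1 + p.alpha 0 * p.rho * p.snr * bestGain p h b ω * priGain p g ω /
    (p.alphaSec * p.rho * p.snr * bestGain p h b ω * priGain p g ω + 1))

variable [MeasurableSpace Ω] (P : MeasureTheory.Measure Ω)

/-- Probability that the selected ST does not decode the primary signal. -/
def outageFirst : ℝ := P.real {ω | rateST p h b ω < p.R0}

/-- Probability that the selected ST decodes the primary signal and PR does not. -/
def outageSecond : ℝ := P.real {ω | p.R0 ≤ rateST p h b ω ∧ ratePR p h g b ω < p.R0}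

/-- The outage probability of the primary network. -/
def outageProb : ℝ := outageFirst p h b P + outageSecond p h g b P

end Rates

/-- Upper incomplete gamma function `Γ(s, x) = ∫_x^∞ t ^ (s - 1) * exp (-t) dt`. -/
def upperGamma (s x : ℝ) : ℝ := ∫ t in Set.Ioi x, t ^ (s - 1) * Real.exp (-t)

/-- The coefficients `C_j` (depending on `N` and `l`): `C_0 = 1`, `C_1 = l` and, for `j ≥ 2`,
`C_j = (1 / j) * ∑_{r=1}^{min (j, N-1)} (r * l - j + r) / r! * C_{j-r}`. -/
def coeffC (N l : ℕ) : ℕ → ℝ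
  | 0 => 1
  | 1 => l
  | j + 2 => 1 / ((j : ℝ) + 2) *
      ∑ r ∈ (Finset.Icc 1 (min (j + 2) (N - 1))).attach,
        ((r.1 : ℝ) * l - ((j : ℝ) + 2) + r.1) / (r.1.factorial : ℝ) * coeffC N l (j + 2 - r.1)
  termination_by j => j
  decreasing_by
    have := (Finset.mem_Icc.1 r.2).1
    omega

theorem coeffC_of_two_le (N l j : ℕ) (hj : 2 ≤ j) :
    coeffC N l j = 1 / (j : ℝ) * ∑ r ∈ Finset.Icc 1 (min j (N - 1)),
      ((r : ℝ) * l - j + r) / (r.factorial : ℝ) * coeffC N l (j - r) := by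
  obtain ⟨j, rfl⟩ := Nat.exists_eq_add_of_le' hj
  rw [coeffC, Finset.sum_attach (Finset.Icc 1 (min (j + 2) (N - 1))) (fun r =>
    ((r : ℝ) * l - ((j : ℝ) + 2) + r) / (r.factorial : ℝ) * coeffC N l (j + 2 - r))]
  push_cast
  rfl

namespace Params

variable (p : Params)

/-- Closed form for the CDF of the best gain from PT. -/
def gainCDF (x : ℝ) : ℝ :=
  ∑ l ∈ Finset.range (p.K + 1), (p.K.choose l : ℝ) * (-1) ^ l * Real.exp (-(l * x / p.lamPS)) *
    ∑ j ∈ Finset.range (l * (p.N - 1) + 1), coeffC p.N l j * x ^ j / p.lamPS ^ j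

/-- Closed form for the density of the best gain from PT on the positive half-line. -/
def gainPDF (x : ℝ) : ℝ :=
  ∑ l ∈ Finset.Icc 1 p.K, (p.K.choose l : ℝ) * (-1) ^ l * Real.exp (-(l * x / p.lamPS)) *
    ∑ j ∈ Finset.range (l * (p.N - 1) + 1), coeffC p.N l j / p.lamPS ^ j *
      ((j : ℝ) * x ^ (j - 1) - l / p.lamPS * x ^ j)

/-- `ι_q = Q! / ((q - 1)! (Q - q)!)` with `Q = M + 1`. -/
def iota (q : ℕ) : ℝ :=
  ((p.M + 1).factorial : ℝ) / (((q - 1).factorial : ℝ) * ((p.M + 1 - q).factorial : ℝ))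

/-- The expansion of the CDF at `x` of the `q`-th smallest among `Q = M + 1` i.i.d. exponential
gains of mean `lamSP`, with `exp (-n * x / lamSP)` replaced by `φ (n * x / lamSP)`. The CDF itself
is the case `φ t = exp (-t)`. -/
def orderCDF (φ : ℝ → ℝ) (q : ℕ) (x : ℝ) : ℝ :=
  p.iota q * ∑ c ∈ Finset.range (p.M + 1 - q + 1), ((p.M + 1 - q).choose c : ℝ) *
    ((-1) ^ c / ((q : ℝ) + c)) *
      ∑ n ∈ Finset.range (q + c + 1), ((q + c).choose n : ℝ) * (-1) ^ n * φ (n * x / p.lamSP)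

/-- The integrand obtained by conditioning on the best gain `x` from PT, with
`exp (-n * Θ₀ / (lamSP * snr * x))` replaced by `φ (n * Θ₀ / (lamSP * snr * x))`. -/
def condIntegrand (φ : ℝ → ℝ) (q : ℕ) (x : ℝ) : ℝ :=
  p.orderCDF φ q (p.theta0 / (p.snr * x)) * p.gainPDF x

/-- The finite sum of upper incomplete gamma terms. -/
def gammaSum (q : ℕ) : ℝ :=
  p.iota q * ∑ c ∈ Finset.range (p.M + 1 - q + 1), ∑ n ∈ Finset.range (q + c + 1),
    ∑ l ∈ Finset.Icc 1 p.K, ∑ j ∈ Finset.range (l * (p.N - 1) + 1),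
      ((p.M + 1 - q).choose c : ℝ) * ((q + c).choose n : ℝ) * (p.K.choose l : ℝ) *
      ((-1) ^ (c + n + l) / ((q : ℝ) + c)) * (coeffC p.N l j / (l : ℝ) ^ j) *
      (((j : ℝ) + n * p.theta0 * l / (p.lamSP * p.lamPS * p.snr)) *
          upperGamma j (l * p.mu / (p.lamPS * p.snr))
        - upperGamma ((j : ℝ) + 1) (l * p.mu / (p.lamPS * p.snr))
        - n * p.theta0 * j * l / (p.lamSP * p.lamPS * p.snr) *
          upperGamma ((j : ℝ) - 1) (l * p.mu / (p.lamPS * p.snr)))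

/-- The closed-form approximation of the outage probability of the primary network (`q = 1`). -/
def outageApprox : ℝ := p.gainCDF (p.mu / p.snr) + p.gammaSum 1

end Params

end CoopNOMA

end

/-! Both outage events are threshold events. Clearing denominators turns "the ST fails" into `X < μ
/ snr`, and, once the ST succeeds, "PR fails" into `Y < Θ₀ / (snr * X)`, where `X` is the best gain
and `Y` the weakest receiver gain. So only the laws of `X` and `Y` and their independence matter.

The gain of one ST is a sum of `N` exponentials, hence Erlang, and the maximum over `K` independent
STs has the `K`-th power of that CDF. Binomial expansion produces powers of the truncated
exponential series, whose coefficients are the `C_j` (`sum_coeffC_mul_pow`); this gives `gainCDF`,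
and its derivative `gainPDF` is the density of `X` on the positive half-line. Fubini then writes the
second outage term as the conditioning integral.

The alternating sums in `orderCDF` collapse: with `a = (M + 1) * Θ₀ / (lamSP * snr * x)`, the
exponential version is `1 - exp (-a)` and the linearised one is exactly `a`. The linearised integral
is a finite sum of incomplete gamma integrals, and the error is the integral of `a - (1 - exp
(-a))`, which lies in `[0, a ^ 2 / 2]`, against the density of `X`. -/

noncomputable section

open MeasureTheory ProbabilityTheory

namespace CoopNOMA

/-! ### Sums, maxima and minima of independent exponentials -/

section IndependentExponentials

/-- The distribution function on `[0, ∞)` of a sum of `n` independent exponential variables of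
rate `r`. -/
def erlangCDF (r : ℝ) (n : ℕ) (x : ℝ) : ℝ :=
  1 - Real.exp (-(r * x)) * ∑ k ∈ Finset.range n, (r * x) ^ k / k.factorial

/-- Since `exp (-(r * y)) * exp (-(r * (x - y)))` does not depend on `y`, the convolution integrand
is an exponential minus a constant times a polynomial in `x - y`, and integrates termwise. The new
powers `k + 1` are what raises the Erlang order by one. -/
theorem hasDerivAt_erlang_antideriv (r x : ℝ) (n : ℕ) (y : ℝ) :
    HasDerivAt (fun y => -Real.exp (-(r * y)) + Real.exp (-(r * x)) *
        ∑ k ∈ Finset.range n, (r * (x - y)) ^ (k + 1) / (k + 1).factorial)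
      (r * Real.exp (-(r * y)) * erlangCDF r n (x - y)) y := by
  have h1 : HasDerivAt (fun y => -Real.exp (-(r * y))) (r * Real.exp (-(r * y))) y :=
    hasDerivAt_neg_exp_mul_exp
  have h2 : HasDerivAt (fun y => r * (x - y)) (-r) y := by
    simpa using ((hasDerivAt_id y).const_sub x).const_mul r
  have h3 : ∀ k ∈ Finset.range n,
      HasDerivAt (fun y => (r * (x - y)) ^ (k + 1) / ((k + 1).factorial : ℝ))
        (-r * ((r * (x - y)) ^ k / (k.factorial : ℝ))) y := by
    intro k _
    convert! (h2.pow (k + 1)).div_const ((k + 1).factorial : ℝ) using 1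
    rw [Nat.factorial_succ]
    have : (k.factorial : ℝ) ≠ 0 := by positivity
    have : (k : ℝ) + 1 ≠ 0 := by positivity
    push_cast
    field_simp
  convert! h1.add ((HasDerivAt.fun_sum h3).const_mul (Real.exp (-(r * x)))) using 1
  have : Real.exp (-(r * x)) = Real.exp (-(r * y)) * Real.exp (-(r * (x - y))) := by
    rw [← Real.exp_add]; ring_nf
  rw [erlangCDF, this, ← Finset.mul_sum]
  ring

theorem integral_mul_erlangCDF (r x : ℝ) (n : ℕ) :
    ∫ y in (0 : ℝ)..x, r * Real.exp (-(r * y)) * erlangCDF r n (x - y) =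
      erlangCDF r (n + 1) x := by
  rw [intervalIntegral.integral_eq_sub_of_hasDerivAt
    (fun y _ => hasDerivAt_erlang_antideriv r x n y)]
  · rw [erlangCDF, Finset.sum_range_succ']
    simp
    ring
  · apply Continuous.intervalIntegrable
    unfold erlangCDF
    fun_prop

variable {Ω : Type*} [MeasurableSpace Ω] {P : Measure Ω}

/-- Fubini for the product law. It serves twice: for the convolution of exponentials and for
conditioning on the best gain. -/
theorem real_mem_eq_integral_of_indepFun [IsProbabilityMeasure P] {α β : Type*}
    [MeasurableSpace α] [MeasurableSpace β] {X : Ω → α} {Y : Ω → β} (hX : Measurable X)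
    (hY : Measurable Y) (hXY : IndepFun X Y P) {A : Set (α × β)} (hA : MeasurableSet A) :
    P.real {ω | (X ω, Y ω) ∈ A} = ∫ x, P.real {ω | (x, Y ω) ∈ A} ∂(P.map X) := by
  have hmap := (indepFun_iff_map_prod_eq_prod_map_map hX.aemeasurable hY.aemeasurable).1 hXY
  have hc : ∀ x, (P.map Y) (Prod.mk x ⁻¹' A) = P {ω | (x, Y ω) ∈ A} := fun x =>
    Measure.map_apply hY (measurable_prodMk_left hA)
  have hcm : Measurable fun x => P {ω | (x, Y ω) ∈ A} := by
    simp_rw [← hc]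
    exact measurable_measure_prodMk_left hA
  have h : P {ω | (X ω, Y ω) ∈ A} = ∫⁻ x, P {ω | (x, Y ω) ∈ A} ∂(P.map X) := by
    simp_rw [← hc]
    rw [← Measure.prod_apply hA, ← hmap, Measure.map_apply (hX.prodMk hY) hA]
    rfl
  rw [measureReal_def, h, ← integral_toReal hcm.aemeasurable
    (Filter.Eventually.of_forall fun x => measure_lt_top P _)]
  rfl

/-- Conditioning on `E = y`; the range stops at `x` because `S` is nonnegative, so the inner event
is empty for `y > x`. -/
theorem real_add_exponential_le [IsProbabilityMeasure P]
    {S E : Ω → ℝ} {r x : ℝ} (hS : Measurable S) (hE : Measurable E)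
    (hSE : IndepFun S E P) (hS0 : ∀ ω, 0 ≤ S ω) (hr : 0 < r) (hlaw : P.map E = expMeasure r)
    (hx : 0 ≤ x) :
    P.real {ω | S ω + E ω ≤ x} =
      ∫ y in (0 : ℝ)..x, r * Real.exp (-(r * y)) * P.real {ω | S ω ≤ x - y} := by
  have hA : MeasurableSet {q : ℝ × ℝ | q.2 + q.1 ≤ x} :=
    measurableSet_le (by fun_prop) (by fun_prop)
  have h1 : P.real {ω | S ω + E ω ≤ x} = ∫ y, P.real {ω | S ω ≤ x - y} ∂expMeasure r := by
    rw [← hlaw]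
    simp_rw [le_sub_iff_add_le]
    exact real_mem_eq_integral_of_indepFun hE hS hSE.symm hA
  rw [h1, expMeasure, gammaMeasure, integral_withDensity_eq_integral_toReal_smul
    (by unfold gammaPDF; fun_prop) (by simp [gammaPDF]), intervalIntegral.integral_of_le hx,
    ← integral_Icc_eq_integral_Ioc, ← integral_indicator measurableSet_Icc]
  congr 1
  ext y
  have hpdf := exponentialPDF_eq r y
  rw [exponentialPDF, exponentialPDFReal] at hpdf
  rw [gammaPDF, hpdf]
  by_cases hy0 : 0 ≤ y
  · by_cases hyx : y ≤ x
    · rw [Set.indicator_of_mem (Set.mem_Icc.2 ⟨hy0, hyx⟩), if_pos hy0,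
        ENNReal.toReal_ofReal (by positivity), smul_eq_mul]
    · rw [Set.indicator_of_notMem (fun h => hyx h.2)]
      have : {ω | S ω ≤ x - y} = ∅ := by
        ext ω
        have := hS0 ω
        simp only [Set.mem_ofPred_eq, Set.mem_empty_iff_false, iff_false]
        linarith
      simp [this]
  · rw [Set.indicator_of_notMem (fun h => hy0 h.1)]
    simp [hy0]

theorem real_sum_exponential_le [IsProbabilityMeasure P]
    {ι : Type*} {E : ι → Ω → ℝ} {r : ℝ} (hr : 0 < r)
    (hE : ∀ i, Measurable (E i)) (hE0 : ∀ i ω, 0 ≤ E i ω) (hind : iIndepFun E P)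
    (s : Finset ι) (hlaw : ∀ i ∈ s, P.map (E i) = expMeasure r) {x : ℝ} (hx : 0 ≤ x) :
    P.real {ω | ∑ i ∈ s, E i ω ≤ x} = erlangCDF r s.card x := by
  classical
  induction s using Finset.induction_on generalizing x with
  | empty => simp [erlangCDF, hx]
  | insert a s ha ih =>
    have hsum : IndepFun (fun ω => ∑ i ∈ s, E i ω) (E a) P := by
      have := hind.indepFun_finsetSum_of_notMem hE ha
      convert this using 1
      ext ω
      simp
    simp_rw [Finset.sum_insert ha, add_comm (E a _)]
    rw [real_add_exponential_le (by fun_prop) (hE a) hsum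
      (fun ω => Finset.sum_nonneg fun i _ => hE0 i ω) hr (hlaw a (by simp)) hx,
      Finset.card_insert_of_notMem ha, ← integral_mul_erlangCDF]
    apply intervalIntegral.integral_congr
    intro y hy
    rw [Set.uIcc_of_le hx] at hy
    simp only
    rw [ih (fun i hi => hlaw i (by simp [hi])) (sub_nonneg.2 hy.2)]

/-- Distinct rows `{k} × ν` are disjoint index blocks of one independent family, so block sums are
independent; rows are split off one at a time. -/
theorem real_forall_sum_le [IsProbabilityMeasure P]
    {κ ν : Type*} [Fintype ν] {E : κ × ν → Ω → ℝ}
    (hE : ∀ i, Measurable (E i)) (hind : iIndepFun E P) (T : Finset κ) (x : ℝ) :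
    P.real {ω | ∀ k ∈ T, ∑ n, E (k, n) ω ≤ x} = ∏ k ∈ T, P.real {ω | ∑ n, E (k, n) ω ≤ x} := by
  classical
  induction T using Finset.induction_on with
  | empty => simp
  | insert a T ha ih =>
    have hdisj : Disjoint (({a} : Finset κ) ×ˢ (Finset.univ : Finset ν))
        (T ×ˢ (Finset.univ : Finset ν)) := by
      rw [Finset.disjoint_left]
      rintro ⟨k, n⟩ h1 h2
      simp only [Finset.mem_product, Finset.mem_singleton, Finset.mem_univ, and_true] at h1 h2
      exact ha (h1 ▸ h2)
    have hI := hind.indepFun_finset _ _ hdisj hE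
    let A : Set ((({a} : Finset κ) ×ˢ (Finset.univ : Finset ν) : Finset _) → ℝ) :=
      {v | ∑ n, v ⟨(a, n), by simp⟩ ≤ x}
    let B : Set ((T ×ˢ (Finset.univ : Finset ν) : Finset _) → ℝ) :=
      {v | ∀ k : T, ∑ n, v ⟨(k.1, n), by simp⟩ ≤ x}
    have hA : MeasurableSet A := measurableSet_le (by fun_prop) (by fun_prop)
    have hB : MeasurableSet B := by
      have : B = ⋂ k : T, {v | ∑ n, v ⟨(k.1, n), by simp⟩ ≤ x} := by
        ext v; simp [B]
      rw [this]
      exact MeasurableSet.iInter fun k => measurableSet_le (by fun_prop) (by fun_prop)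
    have key := hI.measure_inter_preimage_eq_mul A B hA hB
    have hAe : {ω | ∑ n, E (a, n) ω ≤ x} = (fun ω i => E i.1 ω) ⁻¹' A := rfl
    have hBe : {ω | ∀ k ∈ T, ∑ n, E (k, n) ω ≤ x} = (fun ω i => E i.1 ω) ⁻¹' B := by
      ext ω; simp [B]
    have hABe : {ω | ∀ k ∈ insert a T, ∑ n, E (k, n) ω ≤ x} =
        {ω | ∑ n, E (a, n) ω ≤ x} ∩ {ω | ∀ k ∈ T, ∑ n, E (k, n) ω ≤ x} := by
      ext ω; simp
    rw [Finset.prod_insert ha, ← ih, hABe, hAe, hBe]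
    simp only [measureReal_def, ← ENNReal.toReal_mul]
    rw [key]

theorem real_forall_le_exponential {ι : Type*} [Fintype ι] {E : ι → Ω → ℝ} {r : ℝ} (hr : 0 < r)
    (hE : ∀ i, Measurable (E i)) (hind : iIndepFun E P)
    (hlaw : ∀ i, P.map (E i) = expMeasure r) {y : ℝ} (hy : 0 ≤ y) :
    P.real {ω | ∀ i, y ≤ E i ω} = Real.exp (-(Fintype.card ι * (r * y))) := by
  have h1 : ∀ i, P.real {ω | y ≤ E i ω} = Real.exp (-(r * y)) := by
    intro i
    have := isProbabilityMeasure_expMeasure hr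
    have hac : (expMeasure r) ≪ volume := withDensity_absolutelyContinuous _ _
    have h0 : P.real {ω | y ≤ E i ω} = (expMeasure r).real (Set.Ici y) := by
      rw [← hlaw i, map_measureReal_apply (hE i) measurableSet_Ici]; rfl
    have h2 : (expMeasure r).real (Set.Ici y) = (expMeasure r).real (Set.Ioi y) := by
      apply measureReal_congr
      exact hac.ae_eq Ioi_ae_eq_Ici.symm
    rw [h0, h2, ← Set.compl_Iic, probReal_compl_eq_one_sub measurableSet_Iic, ← cdf_eq_real,
      cdf_expMeasure_eq hr, if_pos hy]
    ring
  have h2 : {ω | ∀ i, y ≤ E i ω} = ⋂ i ∈ (Finset.univ : Finset ι), E i ⁻¹' Set.Ici y := by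
    ext ω; simp
  rw [h2, measureReal_def, hind.measure_inter_preimage_eq_mul Finset.univ
    (fun _ _ => measurableSet_Ici), ENNReal.toReal_prod]
  have h3 : ∀ i, (P (E i ⁻¹' Set.Ici y)).toReal = Real.exp (-(r * y)) := h1
  simp_rw [h3]
  rw [Finset.prod_const, ← Real.exp_nat_mul]
  simp

end IndependentExponentials

/-! ### Coefficients of powers of the truncated exponential series -/

open Polynomial in
/-- The truncated exponential series `∑_{k < N} X ^ k / k!`. -/
def expTrunc (N : ℕ) : Polynomial ℝ :=
  ∑ k ∈ Finset.range N, C (1 / (k.factorial : ℝ)) * X ^ k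

theorem coeff_expTrunc (N j : ℕ) :
    (expTrunc N).coeff j = if j < N then 1 / (j.factorial : ℝ) else 0 := by
  simp [expTrunc, Polynomial.finsetSum_coeff, Polynomial.coeff_C_mul, Polynomial.coeff_X_pow]

theorem eval_expTrunc (N : ℕ) (x : ℝ) :
    (expTrunc N).eval x = ∑ k ∈ Finset.range N, x ^ k / k.factorial := by
  simp only [expTrunc, Polynomial.eval_finsetSum, Polynomial.eval_mul, Polynomial.eval_C,
    Polynomial.eval_pow, Polynomial.eval_X]
  exact Finset.sum_congr rfl fun k _ => by ring

theorem natDegree_expTrunc_pow_le (N l : ℕ) : ((expTrunc N) ^ l).natDegree ≤ l * (N - 1) := by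
  refine Polynomial.natDegree_pow_le_of_le l ?_
  rw [Polynomial.natDegree_le_iff_coeff_eq_zero]
  intro j hj
  rw [coeff_expTrunc, if_neg (by omega)]

open Polynomial in
/-- Newton-type recursion for the coefficients of a power of a polynomial. -/
theorem sum_coeff_mul_coeff_pow (e : Polynomial ℝ) (l j : ℕ) :
    ∑ r ∈ Finset.range (j + 1), ((r : ℝ) * l - ((j : ℝ) - r)) * e.coeff r * (e ^ l).coeff (j - r) =
      0 := by
  -- The logarithmic derivative identity `l * e' * e ^ l = e * (e ^ l)'`, multiplied by `X` so that
  -- differentiation multiplies the `n`-th coefficient by `n`. Comparing coefficients of `X ^ j`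
  -- gives the recursion.
  have h : C (l : ℝ) * ((X * derivative e) * e ^ l) = e * (X * derivative (e ^ l)) := by
    rcases l with _ | l
    · simp
    · rw [derivative_pow_succ]
      push_cast
      simp only [map_add, map_natCast, map_one]
      ring
  have hX : ∀ (q : ℝ[X]) (n : ℕ), (X * derivative q).coeff n = n * q.coeff n := by
    intro q n
    rcases n with _ | n
    · simp
    · rw [coeff_X_mul, coeff_derivative]; push_cast; ring
  have h2 := congrArg (fun q => q.coeff j) h
  simp only [coeff_C_mul] at h2
  rw [coeff_mul, coeff_mul, Finset.Nat.sum_antidiagonal_eq_sum_range_succ_mk,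
    Finset.Nat.sum_antidiagonal_eq_sum_range_succ_mk, Finset.mul_sum, ← sub_eq_zero,
    ← Finset.sum_sub_distrib] at h2
  rw [← h2]
  refine Finset.sum_congr rfl fun r hr => ?_
  rw [hX, hX, Nat.cast_sub (by simpa [Nat.lt_succ_iff] using hr)]
  ring

/-- The case `N = 1` is excluded because there the series is `1`, with zero linear coefficient,
while `C_1 = l`. -/
theorem coeff_expTrunc_pow {N : ℕ} (hN : 2 ≤ N) (l j : ℕ) :
    ((expTrunc N) ^ l).coeff j = coeffC N l j := by
  induction j using Nat.strong_induction_on with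
  | _ j ih =>
    have h0 : ((expTrunc N) ^ l).coeff 0 = 1 := by
      rw [Polynomial.coeff_zero_eq_eval_zero, Polynomial.eval_pow,
        ← Polynomial.coeff_zero_eq_eval_zero, coeff_expTrunc, if_pos (by omega)]
      simp
    have hrec := sum_coeff_mul_coeff_pow (expTrunc N) l j
    rw [Finset.sum_range_succ'] at hrec
    rcases j with _ | _ | j
    · rw [h0, coeffC]
    · simp [coeff_expTrunc, h0, show 1 < N by omega, show 0 < N by omega] at hrec
      simp only [zero_add, coeffC]
      linarith
    · rw [coeffC_of_two_le _ _ _ (by omega)]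
      have hj : ((j + 1 + 1 : ℕ) : ℝ) ≠ 0 := by positivity
      -- Coefficients of the truncated series vanish from degree `N` on, which explains the cut-off
      -- at `N - 1`. The missing `r = 0` term is `-j * C_j`, for which the recursion is then solved.
      have hsum : ∑ r ∈ Finset.Icc 1 (min (j + 1 + 1) (N - 1)),
          ((r : ℝ) * l - (j + 1 + 1 : ℕ) + r) / (r.factorial : ℝ) * coeffC N l (j + 1 + 1 - r) =
          ∑ k ∈ Finset.range (j + 1 + 1), (((k + 1 : ℕ) : ℝ) * l - ((j + 1 + 1 : ℕ) - (k + 1 : ℕ))) *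
            (expTrunc N).coeff (k + 1) * ((expTrunc N) ^ l).coeff (j + 1 + 1 - (k + 1)) := by
        have hshift : ∀ F : ℕ → ℝ, ∑ k ∈ Finset.range (j + 1 + 1), F (k + 1) =
            ∑ r ∈ Finset.Icc 1 (j + 1 + 1), F r := by
          intro F
          rw [Finset.range_eq_Ico, Finset.sum_Ico_add' F 0 (j + 1 + 1) 1]
          rfl
        rw [hshift fun r => ((r : ℝ) * l - ((j + 1 + 1 : ℕ) - (r : ℝ))) *
          (expTrunc N).coeff r * ((expTrunc N) ^ l).coeff (j + 1 + 1 - r)]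
        refine Finset.sum_subset_zero_on_sdiff (Finset.Icc_subset_Icc_right (min_le_left _ _))
          (fun r hr => ?_) (fun r hr => ?_)
        · simp only [Finset.mem_sdiff, Finset.mem_Icc] at hr
          rw [coeff_expTrunc, if_neg (by omega)]
          simp
        · simp only [Finset.mem_Icc] at hr
          rw [coeff_expTrunc, if_pos (by omega), ih _ (by omega)]
          ring
      rw [hsum, eq_sub_of_add_eq hrec]
      simp only [coeff_expTrunc, show 0 < N by omega, if_true]
      field_simp
      push_cast
      simp only [Nat.factorial_zero, Nat.cast_one]
      ring

theorem sum_coeffC_mul_pow {N : ℕ} (hN : 1 ≤ N) (l : ℕ) (x : ℝ) :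
    ∑ j ∈ Finset.range (l * (N - 1) + 1), coeffC N l j * x ^ j =
      (∑ k ∈ Finset.range N, x ^ k / k.factorial) ^ l := by
  rcases hN.eq_or_lt with rfl | hN
  -- For `N = 1` only `j = 0` occurs, so the discrepancy at `C_1` does no harm.
  · simp [coeffC]
  · rw [← eval_expTrunc, ← Polynomial.eval_pow, Polynomial.eval_eq_sum_range'
      (Nat.lt_succ_of_le (natDegree_expTrunc_pow_le N l))]
    simp_rw [coeff_expTrunc_pow hN]

theorem Params.gainCDF_eq_erlangCDF_pow {p : Params} (hp : p.Valid) (x : ℝ) :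
    p.gainCDF x = erlangCDF (1 / p.lamPS) p.N x ^ p.K := by
  rw [erlangCDF, sub_eq_neg_add, add_pow, Params.gainCDF]
  refine Finset.sum_congr rfl fun l _ => ?_
  have := sum_coeffC_mul_pow hp.one_le_N l (1 / p.lamPS * x)
  rw [neg_pow (Real.exp _ * _), mul_pow, ← this, ← Real.exp_nat_mul]
  have h1 : ∀ j, coeffC p.N l j * (1 / p.lamPS * x) ^ j = coeffC p.N l j * x ^ j / p.lamPS ^ j := by
    intro j
    rw [mul_pow, div_pow]; ring
  simp_rw [h1]
  rw [show (l : ℝ) * -(1 / p.lamPS * x) = -(l * x / p.lamPS) by ring]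
  ring

/-! ### Alternating binomial sums in the order-statistic expansion -/

theorem sum_choose_neg_one_pow_div (M : ℕ) (u : ℝ) :
    ((M : ℝ) + 1) * ∑ c ∈ Finset.range (M + 1), (M.choose c : ℝ) * ((-1) ^ c / (1 + (c : ℝ))) *
      u ^ (1 + c) = 1 - (1 - u) ^ (M + 1) := by
  have h : (1 - u) ^ (M + 1) = ∑ m ∈ Finset.range (M + 2), (-u) ^ m * ((M + 1).choose m : ℝ) := by
    rw [show 1 - u = -u + 1 by ring, add_pow]
    simp
  rw [h, Finset.sum_range_succ' _ (M + 1), Finset.mul_sum]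
  simp only [pow_zero, Nat.choose_zero_right, Nat.cast_one, mul_one, sub_add_cancel_right]
  rw [← Finset.sum_neg_distrib]
  refine Finset.sum_congr rfl fun c _ => ?_
  have h2 : ((M : ℝ) + 1) * (M.choose c : ℝ) = ((M + 1).choose (c + 1) : ℝ) * ((c : ℝ) + 1) := by
    exact_mod_cast Nat.add_one_mul_choose_eq M c
  have h3 : (1 + (c : ℝ)) ≠ 0 := by positivity
  field_simp
  rw [neg_pow u, h2, pow_succ (-1 : ℝ)]
  ring

theorem sum_choose_neg_one_pow_exp (m : ℕ) (t : ℝ) :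
    ∑ n ∈ Finset.range (m + 1), (m.choose n : ℝ) * (-1) ^ n * Real.exp (-(n * t)) =
      (1 - Real.exp (-t)) ^ m := by
  rw [sub_eq_neg_add, add_pow]
  refine Finset.sum_congr rfl fun n _ => ?_
  rw [neg_pow (Real.exp _), ← Real.exp_nat_mul]
  ring_nf

/-- The sum is, up to sign, a finite difference of order `m + 1` of a polynomial of degree at most
one, so it vanishes unless the order is one. -/
theorem sum_choose_neg_one_pow_linear (m : ℕ) (t : ℝ) :
    ∑ n ∈ Finset.range (m + 2), ((m + 1).choose n : ℝ) * (-1) ^ n * (1 - n * t) =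
      if m = 0 then t else 0 := by
  have h1 : ∑ n ∈ Finset.range (m + 2), ((m + 1).choose n : ℝ) * (-1) ^ n = 0 := by
    have := add_pow (-1 : ℝ) 1 (m + 1)
    simp only [one_pow, mul_one, neg_add_cancel, ne_eq, Nat.add_eq_zero_iff, one_ne_zero, and_false,
      not_false_eq_true, zero_pow] at this
    rw [this]
    exact Finset.sum_congr rfl fun n _ => by ring
  have h2 : ∑ n ∈ Finset.range (m + 2), ((m + 1).choose n : ℝ) * (-1) ^ n * n =
      if m = 0 then -1 else 0 := by
    rw [Finset.sum_range_succ']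
    have h3 : ∀ n ∈ Finset.range (m + 1),
        ((m + 1).choose (n + 1) : ℝ) * (-1) ^ (n + 1) * ((n + 1 : ℕ) : ℝ) =
        -((m : ℝ) + 1) * ((-1) ^ n * 1 ^ (m - n) * (m.choose n : ℝ)) := by
      intro n _
      have h2 : ((m : ℝ) + 1) * (m.choose n : ℝ) = ((m + 1).choose (n + 1) : ℝ) * ((n : ℝ) + 1) := by
        exact_mod_cast Nat.add_one_mul_choose_eq m n
      push_cast
      rw [pow_succ]
      linear_combination (-1) ^ n * h2
    rw [Finset.sum_congr rfl h3, ← Finset.mul_sum, ← add_pow]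
    rcases m with _ | m <;> simp
  simp_rw [mul_sub, mul_one, ← mul_assoc]
  rw [Finset.sum_sub_distrib, h1, ← Finset.sum_mul, h2]
  split_ifs <;> simp

theorem Params.iota_one (p : Params) : p.iota 1 = (p.M : ℝ) + 1 := by
  have : (p.M.factorial : ℝ) ≠ 0 := by positivity
  rw [Params.iota]
  simp [Nat.factorial_succ]
  field_simp

theorem Params.orderCDF_exp (p : Params) (x : ℝ) :
    p.orderCDF (fun t => Real.exp (-t)) 1 x =
      1 - Real.exp (-(((p.M : ℝ) + 1) * x / p.lamSP)) := by
  have h : ∀ c, ∑ n ∈ Finset.range (1 + c + 1), ((1 + c).choose n : ℝ) * (-1) ^ n *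
      Real.exp (-(n * x / p.lamSP)) = (1 - Real.exp (-(x / p.lamSP))) ^ (1 + c) := by
    intro c
    simp_rw [mul_div_assoc]
    exact sum_choose_neg_one_pow_exp _ _
  rw [Params.orderCDF, Params.iota_one]
  simp only [Nat.add_sub_cancel, Nat.cast_one, h]
  rw [sum_choose_neg_one_pow_div, sub_sub_cancel, ← Real.exp_nat_mul]
  push_cast
  ring_nf

/-- Only `c = 0` survives. The value is the first-order part of `orderCDF_exp`, so the many separate
linearisations amount to a single one. -/
theorem Params.orderCDF_linear (p : Params) (x : ℝ) :
    p.orderCDF (fun t => 1 - t) 1 x = ((p.M : ℝ) + 1) * x / p.lamSP := by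
  have h : ∀ c, ∑ n ∈ Finset.range (1 + c + 1), ((1 + c).choose n : ℝ) * (-1) ^ n *
      (1 - n * x / p.lamSP) = if c = 0 then x / p.lamSP else 0 := by
    intro c
    simp_rw [mul_div_assoc, add_comm 1 c]
    exact sum_choose_neg_one_pow_linear _ _
  rw [Params.orderCDF, Params.iota_one]
  simp only [Nat.add_sub_cancel, Nat.cast_one, h]
  simp
  ring

/-! ### Derivative and limit of the CDF of the best gain -/

theorem Params.hasDerivAt_gainCDF (p : Params) (x : ℝ) :
    HasDerivAt p.gainCDF (p.gainPDF x) x := by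
  have hterm : ∀ l ∈ Finset.range (p.K + 1), HasDerivAt
      (fun x => (p.K.choose l : ℝ) * (-1) ^ l * Real.exp (-(l * x / p.lamPS)) *
        ∑ j ∈ Finset.range (l * (p.N - 1) + 1), coeffC p.N l j * x ^ j / p.lamPS ^ j)
      ((p.K.choose l : ℝ) * (-1) ^ l * Real.exp (-(l * x / p.lamPS)) *
        ∑ j ∈ Finset.range (l * (p.N - 1) + 1), coeffC p.N l j / p.lamPS ^ j *
          ((j : ℝ) * x ^ (j - 1) - l / p.lamPS * x ^ j)) x := by
    intro l _
    have h1 : HasDerivAt (fun x : ℝ => Real.exp (-(l * x / p.lamPS)))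
        (Real.exp (-(l * x / p.lamPS)) * (-(l / p.lamPS))) x := by
      have : HasDerivAt (fun x : ℝ => -(l * x / p.lamPS)) (-(l / p.lamPS)) x := by
        simpa using (((hasDerivAt_id x).const_mul (l : ℝ)).div_const p.lamPS).fun_neg
      exact this.exp
    have h2 : HasDerivAt (fun x : ℝ => ∑ j ∈ Finset.range (l * (p.N - 1) + 1),
          coeffC p.N l j * x ^ j / p.lamPS ^ j)
        (∑ j ∈ Finset.range (l * (p.N - 1) + 1),
          coeffC p.N l j * ((j : ℝ) * x ^ (j - 1)) / p.lamPS ^ j) x :=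
      HasDerivAt.fun_sum fun j _ => ((hasDerivAt_pow j x).const_mul _).div_const _
    convert! (h1.const_mul ((p.K.choose l : ℝ) * (-1) ^ l)).mul h2 using 1
    have h3 : ∀ j, coeffC p.N l j / p.lamPS ^ j * ((j : ℝ) * x ^ (j - 1) - l / p.lamPS * x ^ j) =
        coeffC p.N l j * ((j : ℝ) * x ^ (j - 1)) / p.lamPS ^ j -
          l / p.lamPS * (coeffC p.N l j * x ^ j / p.lamPS ^ j) := fun j => by ring
    simp_rw [h3]
    rw [Finset.sum_sub_distrib, ← Finset.mul_sum]
    ring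
  have h := HasDerivAt.fun_sum hterm
  convert! h using 1
  -- The `l = 0` term of the CDF is constant, so the density starts at `l = 1`.
  rw [Finset.range_eq_Ico, Finset.sum_eq_sum_Ico_succ_bot (Nat.succ_pos _)]
  simp [Params.gainPDF]
  rfl

open Filter Topology in
theorem tendsto_erlangCDF {r : ℝ} (hr : 0 < r) (n : ℕ) :
    Tendsto (erlangCDF r n) atTop (𝓝 1) := by
  have h : ∀ k ∈ Finset.range n,
      Tendsto (fun x => Real.exp (-(r * x)) * ((r * x) ^ k / (k.factorial : ℝ))) atTop (𝓝 0) := by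
    intro k _
    have h1 := ((Real.tendsto_pow_mul_exp_neg_atTop_nhds_zero k).comp
      (tendsto_id.const_mul_atTop hr)).div_const (k.factorial : ℝ)
    rw [zero_div] at h1
    exact h1.congr fun x => by simp; ring
  have h2 := (tendsto_finsetSum _ h).const_sub 1
  simp only [Finset.sum_const_zero, sub_zero] at h2
  exact h2.congr fun x => by rw [erlangCDF, Finset.mul_sum]

open Filter Topology in
theorem Params.tendsto_gainCDF {p : Params} (hp : p.Valid) :
    Tendsto p.gainCDF atTop (𝓝 1) := by
  have h := (tendsto_erlangCDF (one_div_pos.2 hp.lamPS_pos) p.N).pow p.K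
  rw [one_pow] at h
  exact h.congr fun x => (Params.gainCDF_eq_erlangCDF_pow hp x).symm

/-! ### From a differentiable CDF on the half-line to a density -/

section Density

open Filter Topology

variable {ν : Measure ℝ} [IsProbabilityMeasure ν] {F f : ℝ → ℝ}

theorem density_nonneg_of_hasDerivAt (hF : ∀ x, 0 ≤ x → ν.real (Set.Iic x) = F x)
    (hf : ∀ x, HasDerivAt F (f x) x) {x : ℝ} (hx : 0 < x) : 0 ≤ f x := by
  have hmono : Monotone fun y => ν.real (Set.Iic y) := fun a b hab =>
    measureReal_mono (Set.Iic_subset_Iic.2 hab)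
  refine HasDerivAt.nonneg_of_monotone (x := x) ?_ hmono
  refine (hf x).congr_of_eventuallyEq ?_
  filter_upwards [lt_mem_nhds hx] with y hy using hF y hy.le

theorem integrableOn_density (hF : ∀ x, 0 ≤ x → ν.real (Set.Iic x) = F x)
    (hf : ∀ x, HasDerivAt F (f x) x) (hlim : Tendsto F atTop (𝓝 1)) :
    IntegrableOn f (Set.Ioi 0) :=
  integrableOn_Ioi_deriv_of_nonneg' (fun x _ => hf x)
    (fun _ hx => density_nonneg_of_hasDerivAt hF hf hx) hlim

/-- Finite measures on the line are determined by half-open intervals, where the fundamental theorem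
of calculus identifies the two sides. -/
theorem restrict_Ioi_eq_withDensity (hF : ∀ x, 0 ≤ x → ν.real (Set.Iic x) = F x)
    (hf : ∀ x, HasDerivAt F (f x) x) (hlim : Tendsto F atTop (𝓝 1)) {a : ℝ} (ha : 0 ≤ a) :
    ν.restrict (Set.Ioi a) =
      (volume.restrict (Set.Ioi a)).withDensity fun x => ENNReal.ofReal (f x) := by
  refine Measure.ext_of_Ioc _ _ fun c d _ => ?_
  rw [withDensity_apply _ measurableSet_Ioc, Measure.restrict_restrict measurableSet_Ioc,
    Measure.restrict_apply measurableSet_Ioc]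
  have hset : Set.Ioc c d ∩ Set.Ioi a = Set.Ioc (max c a) d := by
    ext x; simp only [Set.mem_inter_iff, Set.mem_Ioc, Set.mem_Ioi, max_lt_iff]; tauto
  rw [hset]
  rcases le_or_gt d (max c a) with hd | hd
  · simp [Set.Ioc_eq_empty (not_lt.2 hd)]
  have hm : 0 ≤ max c a := ha.trans (le_max_right _ _)
  have hsub : Set.Ioc (max c a) d ⊆ Set.Ioi 0 := fun x hx => hm.trans_lt hx.1
  have hint : IntegrableOn f (Set.Ioc (max c a) d) :=
    (integrableOn_density hF hf hlim).mono_set hsub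
  rw [← ofReal_integral_eq_lintegral_ofReal hint
    ((ae_restrict_iff' measurableSet_Ioc).2 (Eventually.of_forall fun x hx =>
      density_nonneg_of_hasDerivAt hF hf (hsub hx))), ← intervalIntegral.integral_of_le hd.le,
    intervalIntegral.integral_eq_sub_of_hasDerivAt (fun x _ => hf x)
      ((intervalIntegrable_iff_integrableOn_Ioc_of_le hd.le).2 hint),
    ← hF _ hm, ← hF _ (hm.trans hd.le), ← Set.Iic_sdiff_Iic,
    ← measureReal_sdiff (Set.Iic_subset_Iic.2 hd.le) measurableSet_Iic, measureReal_def,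
    ENNReal.ofReal_toReal (measure_ne_top _ _)]

theorem setIntegral_Ioi_eq_setIntegral_mul_density
    (hF : ∀ x, 0 ≤ x → ν.real (Set.Iic x) = F x)
    (hf : ∀ x, HasDerivAt F (f x) x) (hlim : Tendsto F atTop (𝓝 1)) {a : ℝ} (ha : 0 ≤ a)
    (w : ℝ → ℝ) :
    ∫ x in Set.Ioi a, w x ∂ν = ∫ x in Set.Ioi a, w x * f x := by
  have hint : IntegrableOn f (Set.Ioi a) :=
    (integrableOn_density hF hf hlim).mono_set (Set.Ioi_subset_Ioi ha)
  rw [restrict_Ioi_eq_withDensity hF hf hlim ha, integral_withDensity_eq_integral_toReal_smul₀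
    hint.aestronglyMeasurable.aemeasurable.ennreal_ofReal (by simp)]
  refine setIntegral_congr_fun measurableSet_Ioi fun x hx => ?_
  simp only [smul_eq_mul]
  rw [ENNReal.toReal_ofReal (density_nonneg_of_hasDerivAt hF hf (ha.trans_lt hx)), mul_comm]

theorem measure_singleton_eq_zero_of_hasDerivAt (hF : ∀ x, 0 ≤ x → ν.real (Set.Iic x) = F x)
    (hf : ∀ x, HasDerivAt F (f x) x) (hlim : Tendsto F atTop (𝓝 1)) {x : ℝ} (hx : 0 < x) :
    ν {x} = 0 := by
  have h := congrArg (fun m : Measure ℝ => m {x})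
    (restrict_Ioi_eq_withDensity hF hf hlim (le_refl 0))
  rw [Measure.restrict_apply (measurableSet_singleton x),
    Set.inter_eq_left.2 (Set.singleton_subset_iff.2 (Set.mem_Ioi.2 hx))] at h
  rw [h]
  exact withDensity_absolutelyContinuous _ _ (by simp)

end Density

/-! ### Incomplete gamma integrals and the linearised integral -/

section UpperGamma

open Filter Asymptotics in
-- Every real `s` is allowed, since the domain stays away from `0`; orders `0` and `-1` do occur
-- later.
theorem integrableOn_rpow_mul_exp_neg {a c : ℝ} (ha : 0 < a) (hc : 0 < c) (s : ℝ) :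
    IntegrableOn (fun x => x ^ (s - 1) * Real.exp (-(c * x))) (Set.Ioi a) := by
  refine integrable_of_isBigO_exp_neg (half_pos hc) ?_ ?_
  · exact ContinuousOn.mul (continuousOn_id.rpow_const fun x hx =>
      Or.inl (ha.trans_le hx).ne') (by fun_prop)
  · have h := ((isLittleO_rpow_exp_pos_mul_atTop (s - 1) (half_pos hc)).isBigO).mul
      (isBigO_refl (fun x => Real.exp (-(c * x))) atTop)
    refine h.congr_right fun x => ?_
    rw [← Real.exp_add]
    ring_nf

theorem integral_rpow_mul_exp_neg_Ioi {a c : ℝ} (ha : 0 < a) (hc : 0 < c) (s : ℝ) :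
    ∫ x in Set.Ioi a, x ^ (s - 1) * Real.exp (-(c * x)) = c ^ (-s) * upperGamma s (c * a) := by
  have h := integral_comp_mul_left_Ioi (fun t => t ^ (s - 1) * Real.exp (-t)) a hc
  rw [← upperGamma, setIntegral_congr_fun (g := fun x => c ^ (s - 1) *
    (x ^ (s - 1) * Real.exp (-(c * x)))) measurableSet_Ioi (fun x hx => by
      simp only
      rw [Real.mul_rpow hc.le (ha.trans hx).le, mul_assoc]), integral_const_mul] at h
  have hc1 : c ^ (-s) * c ^ (s - 1) = c⁻¹ := by
    rw [← Real.rpow_add hc, ← Real.rpow_neg_one]; ring_nf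
  have hne : c ^ (s - 1) ≠ 0 := (Real.rpow_pos_of_pos hc _).ne'
  rw [smul_eq_mul, ← hc1] at h
  refine mul_left_cancel₀ hne (h.trans ?_)
  ring

/-- Integrability and value travel together, so that the fourfold sum below is handled by nesting
this lemma. -/
theorem integrableOn_and_integral_sum {ι : Type*} {s : Finset ι} {S : Set ℝ} {u : ι → ℝ → ℝ}
    {v : ι → ℝ} (h : ∀ i ∈ s, IntegrableOn (u i) S ∧ ∫ x in S, u i x = v i) :
    IntegrableOn (fun x => ∑ i ∈ s, u i x) S ∧ ∫ x in S, ∑ i ∈ s, u i x = ∑ i ∈ s, v i :=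
  ⟨integrable_finsetSum _ fun i hi => (h i hi).1,
    (integral_finsetSum _ fun i hi => (h i hi).1).trans
      (Finset.sum_congr rfl fun i hi => (h i hi).2)⟩

/-- Expanding the product leaves the powers `x ^ (j - 1)`, `x ^ j` and `x ^ (j - 2)`, and the
substitution `t = c * x` turns each into one gamma term. -/
theorem integrableOn_and_integral_gamma_term {a c : ℝ} (ha : 0 < a) (hc : 0 < c) (A : ℝ) (j : ℕ) :
    IntegrableOn (fun x => (1 - A / x) * (Real.exp (-(c * x)) *
      ((j : ℝ) * x ^ (j - 1) - c * x ^ j))) (Set.Ioi a) ∧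
    ∫ x in Set.Ioi a, (1 - A / x) * (Real.exp (-(c * x)) *
      ((j : ℝ) * x ^ (j - 1) - c * x ^ j)) =
      1 / c ^ j * (((j : ℝ) + A * c) * upperGamma j (c * a) - upperGamma ((j : ℝ) + 1) (c * a)
        - A * j * c * upperGamma ((j : ℝ) - 1) (c * a)) := by
  have hI := fun s => integrableOn_rpow_mul_exp_neg ha hc s
  have hcongr : Set.EqOn (fun x => (1 - A / x) * (Real.exp (-(c * x)) *
      ((j : ℝ) * x ^ (j - 1) - c * x ^ j)))
      (fun x => ((j : ℝ) + A * c) * (x ^ ((j : ℝ) - 1) * Real.exp (-(c * x))) -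
        c * (x ^ ((j : ℝ) + 1 - 1) * Real.exp (-(c * x))) -
        A * j * (x ^ ((j : ℝ) - 1 - 1) * Real.exp (-(c * x)))) (Set.Ioi a) := by
    intro x hx
    have hx0 : 0 < x := ha.trans hx
    simp only
    rw [Real.rpow_sub_one hx0.ne' ((j : ℝ) - 1), Real.rpow_sub_one hx0.ne' (j : ℝ),
      add_sub_cancel_right, Real.rpow_natCast]
    -- For `j = 0` the natural-number exponent `j - 1` truncates to `0`, harmlessly, because of the
    -- factor `j`.
    rcases j with _ | j
    · simp
      field_simp
      ring
    · simp only [Nat.add_sub_cancel, pow_succ]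
      field_simp
      ring
  have h1 := (hI (j : ℝ)).const_mul ((j : ℝ) + A * c)
  have h2 := (hI ((j : ℝ) + 1)).const_mul c
  have h3 := (hI ((j : ℝ) - 1)).const_mul (A * j)
  refine ⟨IntegrableOn.congr_fun ((h1.sub h2).sub h3) hcongr.symm measurableSet_Ioi, ?_⟩
  have hs := integral_sub (h1.sub h2) h3
  have hs' := integral_sub h1 h2
  simp only [Pi.sub_apply] at hs
  rw [setIntegral_congr_fun measurableSet_Ioi hcongr, hs, hs']
  simp only [integral_const_mul, integral_rpow_mul_exp_neg_Ioi ha hc]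
  have e1 : c ^ (-(j : ℝ)) = 1 / c ^ j := by
    rw [Real.rpow_neg hc.le, Real.rpow_natCast, one_div]
  have e2 : c ^ (-((j : ℝ) + 1)) = 1 / c ^ j / c := by
    rw [neg_add', Real.rpow_sub_one hc.ne', e1]
  have e3 : c ^ (-((j : ℝ) - 1)) = 1 / c ^ j * c := by
    rw [neg_sub, sub_eq_add_neg, Real.rpow_add hc, e1, Real.rpow_one, mul_comm]
  rw [e1, e2, e3]
  field_simp

end UpperGamma

theorem Params.integrableOn_and_integral_condIntegrand_linear {p : Params} (hp : p.Valid)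
    (hmu : 0 < p.mu) :
    IntegrableOn (p.condIntegrand (fun t => 1 - t) 1) (Set.Ioi (p.mu / p.snr)) ∧
    ∫ x in Set.Ioi (p.mu / p.snr), p.condIntegrand (fun t => 1 - t) 1 x = p.gammaSum 1 := by
  have ha : 0 < p.mu / p.snr := div_pos hmu hp.snr_pos
  have hps := hp.lamPS_pos
  have hsp := hp.lamSP_pos
  have hsnr := hp.snr_pos
  have key := fun (c n l j : ℕ) (hl : l ∈ Finset.Icc 1 p.K) =>
    integrableOn_and_integral_gamma_term ha
      (div_pos (Nat.cast_pos.2 (Finset.mem_Icc.1 hl).1 : (0 : ℝ) < l) hps)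
      (n * p.theta0 / (p.lamSP * p.snr)) j
  have hsum := integrableOn_and_integral_sum (s := Finset.range (p.M + 1 - 1 + 1))
    (S := Set.Ioi (p.mu / p.snr)) fun c _ =>
    integrableOn_and_integral_sum (s := Finset.range (1 + c + 1)) fun n _ =>
    integrableOn_and_integral_sum (s := Finset.Icc 1 p.K) fun l hl =>
    integrableOn_and_integral_sum (s := Finset.range (l * (p.N - 1) + 1)) fun j _ =>
    And.intro ((key c n l j hl).1.const_mul (((p.M + 1 - 1).choose c : ℝ) *
      ((1 + c).choose n : ℝ) * (p.K.choose l : ℝ) * ((-1) ^ (c + n + l) / (((1 : ℕ) : ℝ) + c)) *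
        (coeffC p.N l j / p.lamPS ^ j)))
      ((integral_const_mul _ _).trans (congrArg _ (key c n l j hl).2))
  have hcongr : Set.EqOn (p.condIntegrand (fun t => 1 - t) 1) (fun x => p.iota 1 *
      ∑ c ∈ Finset.range (p.M + 1 - 1 + 1), ∑ n ∈ Finset.range (1 + c + 1),
      ∑ l ∈ Finset.Icc 1 p.K, ∑ j ∈ Finset.range (l * (p.N - 1) + 1),
      (((p.M + 1 - 1).choose c : ℝ) *
      ((1 + c).choose n : ℝ) * (p.K.choose l : ℝ) * ((-1) ^ (c + n + l) / (((1 : ℕ) : ℝ) + c)) *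
        (coeffC p.N l j / p.lamPS ^ j)) * ((1 - n * p.theta0 / (p.lamSP * p.snr) / x) *
        (Real.exp (-(l / p.lamPS * x)) * ((j : ℝ) * x ^ (j - 1) - l / p.lamPS * x ^ j))))
      (Set.Ioi (p.mu / p.snr)) := by
    intro x hx
    have hx0 : 0 < x := ha.trans hx
    simp only [Params.condIntegrand, Params.orderCDF, Params.gainPDF]
    rw [mul_assoc, Finset.sum_mul]
    congr 1
    refine Finset.sum_congr rfl fun c _ => ?_
    rw [mul_assoc, Finset.sum_mul, Finset.mul_sum]
    refine Finset.sum_congr rfl fun n _ => ?_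
    rw [Finset.mul_sum, Finset.mul_sum]
    refine Finset.sum_congr rfl fun l _ => ?_
    rw [Finset.mul_sum, Finset.mul_sum, Finset.mul_sum]
    refine Finset.sum_congr rfl fun j _ => ?_
    rw [pow_add, pow_add, mul_div_right_comm (l : ℝ) x p.lamPS,
      show (n : ℝ) * (p.theta0 / (p.snr * x)) / p.lamSP =
        n * p.theta0 / (p.lamSP * p.snr) / x by field_simp]
    ring
  refine ⟨IntegrableOn.congr_fun (hsum.1.const_mul (p.iota 1)) hcongr.symm measurableSet_Ioi, ?_⟩
  rw [setIntegral_congr_fun measurableSet_Ioi hcongr, integral_const_mul, hsum.2, Params.gammaSum]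
  congr 1
  refine Finset.sum_congr rfl fun c _ => Finset.sum_congr rfl fun n _ =>
    Finset.sum_congr rfl fun l hl => Finset.sum_congr rfl fun j _ => ?_
  have hl0 : (0 : ℝ) < l := Nat.cast_pos.2 (Finset.mem_Icc.1 hl).1
  rw [mul_assoc _ (coeffC p.N l j / p.lamPS ^ j), ← mul_assoc (coeffC p.N l j / p.lamPS ^ j),
    show coeffC p.N l j / p.lamPS ^ j * (1 / (l / p.lamPS) ^ j) = coeffC p.N l j / (l : ℝ) ^ j by
      rw [div_pow]; field_simp,
    show (l : ℝ) / p.lamPS * (p.mu / p.snr) = l * p.mu / (p.lamPS * p.snr) by field_simp,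
    show (n : ℝ) * p.theta0 / (p.lamSP * p.snr) * (l / p.lamPS) =
      n * p.theta0 * l / (p.lamSP * p.lamPS * p.snr) by field_simp,
    show (n : ℝ) * p.theta0 / (p.lamSP * p.snr) * j * (l / p.lamPS) =
      n * p.theta0 * j * l / (p.lamSP * p.lamPS * p.snr) by field_simp]
  ring

/-! ### Parameter signs and decoding thresholds -/

section Parameters

variable {p : Params}

theorem Params.Valid.rho_pos (hp : p.Valid) : 0 < p.rho := by
  have := hp.eta_pos
  have := hp.beta_pos
  have := hp.xi_pos
  have := hp.psi_pos
  exact div_pos (by positivity) (sub_pos.2 hp.harvest_lt_one)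

theorem Params.Valid.gamma0_pos (hp : p.Valid) : 0 < p.gamma0 :=
  sub_pos.2 (Real.one_lt_rpow (by norm_num) hp.R0_pos)

theorem Params.Valid.alphaSec_nonneg (hp : p.Valid) : 0 ≤ p.alphaSec :=
  Finset.sum_nonneg fun _ _ => hp.alpha_nonneg _

theorem Params.Valid.mu_pos (hp : p.Valid) (hf : p.Feasible) : 0 < p.mu := by
  refine div_pos hp.gamma0_pos (mul_pos (sub_pos.2 hp.beta_lt_one) ?_)
  have := hf.1
  rw [mul_assoc]
  linarith

theorem Params.Valid.theta0_pos (hp : p.Valid) (hf : p.Feasible) : 0 < p.theta0 := by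
  refine div_pos hp.gamma0_pos (mul_pos hp.rho_pos ?_)
  have := hf.2
  linarith

theorem logb_one_add_lt_iff {u : ℝ} (hu : 0 ≤ u) :
    Real.logb 2 (1 + u) < p.R0 ↔ u < p.gamma0 := by
  rw [Real.logb_lt_iff_lt_rpow (by norm_num) (by linarith), Params.gamma0, lt_sub_iff_add_lt']

end Parameters

section Thresholds

variable {Ω : Type*} {p : Params} {h : Fin p.K → Fin p.N → Ω → ℂ} {g : Fin (p.M + 1) → Ω → ℂ}
  {b : Ω → Fin p.K}

theorem bestGain_nonneg (ω : Ω) : 0 ≤ bestGain p h b ω := by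
  unfold bestGain gainST
  positivity

theorem priGain_nonneg (ω : Ω) : 0 ≤ priGain p g ω :=
  Finset.le_inf' _ _ fun _ _ => by positivity

theorem bestGain_le_iff (hb : IsBestST p h b) (ω : Ω) (x : ℝ) :
    bestGain p h b ω ≤ x ↔ ∀ k, gainST p h k ω ≤ x :=
  ⟨fun hx k => (hb ω k).trans hx, fun hx => hx _⟩

/-- The selector `b` need not be measurable; the maximum it attains is, which gives the
measurability and independence of the best gain. -/
theorem bestGain_eq_sup' (hb : IsBestST p h b) (hK : (Finset.univ : Finset (Fin p.K)).Nonempty)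
    (ω : Ω) : bestGain p h b ω = Finset.univ.sup' hK fun k => gainST p h k ω :=
  le_antisymm (Finset.le_sup' (fun k => gainST p h k ω) (Finset.mem_univ (b ω)))
    (Finset.sup'_le _ _ fun k _ => hb ω k)

/-- Without division by `1 - γ₀ * ρ * ISI` the criterion holds for either sign of that factor: a
positive factor gives the threshold `μ / snr`, a nonpositive one certain outage. -/
theorem rateST_lt_iff (hp : p.Valid) (ω : Ω) :
    rateST p h b ω < p.R0 ↔
      bestGain p h b ω * (p.snr * ((1 - p.beta) * (1 - p.gamma0 * p.rho * p.ISI))) < p.gamma0 := by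
  have hX := bestGain_nonneg (p := p) (h := h) (b := b) ω
  have hb := sub_pos.2 hp.beta_lt_one
  have hrho := hp.rho_pos
  have hI := hp.ISI_nonneg
  have hs := hp.snr_pos
  rw [rateST, logb_one_add_lt_iff (by positivity), div_lt_iff₀ (by positivity),
    ← sub_neg, ← sub_neg (b := p.gamma0)]
  ring_nf

theorem rateST_lt_iff_of_feasible (hp : p.Valid) (hf : p.Feasible) (ω : Ω) :
    rateST p h b ω < p.R0 ↔ bestGain p h b ω < p.mu / p.snr := by
  have h1 : 0 < 1 - p.gamma0 * p.rho * p.ISI := by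
    have := hf.1
    rw [mul_assoc]
    linarith
  rw [rateST_lt_iff hp, Params.mu, div_div, mul_comm p.snr,
    lt_div_iff₀ (mul_pos (mul_pos (sub_pos.2 hp.beta_lt_one) h1) hp.snr_pos)]

theorem ratePR_lt_iff (hp : p.Valid) (ω : Ω) :
    ratePR p h g b ω < p.R0 ↔
      priGain p g ω * (p.snr * bestGain p h b ω * (p.rho * (p.alpha 0 - p.alphaSec * p.gamma0))) <
        p.gamma0 := by
  have hX := bestGain_nonneg (p := p) (h := h) (b := b) ω
  have hY := priGain_nonneg (p := p) (g := g) ω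
  have hrho := hp.rho_pos
  have hs := hp.snr_pos
  have h0 := hp.alpha_nonneg 0
  have h1 := hp.alphaSec_nonneg
  rw [ratePR, logb_one_add_lt_iff (by positivity), div_lt_iff₀ (by positivity),
    ← sub_neg, ← sub_neg (b := p.gamma0)]
  ring_nf

theorem ratePR_lt_iff_of_feasible (hp : p.Valid) (hf : p.Feasible) {ω : Ω}
    (hX : 0 < bestGain p h b ω) :
    ratePR p h g b ω < p.R0 ↔ priGain p g ω < p.theta0 / (p.snr * bestGain p h b ω) := by
  have h1 : 0 < p.alpha 0 - p.alphaSec * p.gamma0 := by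
    have := hf.2
    linarith
  rw [ratePR_lt_iff hp, Params.theta0, div_div, mul_comm (p.snr * bestGain p h b ω),
    lt_div_iff₀ (mul_pos (mul_pos hp.rho_pos h1) (mul_pos hp.snr_pos hX))]

variable [MeasurableSpace Ω]

theorem outageProb_of_not_feasible (P : Measure Ω) [IsProbabilityMeasure P] (hp : p.Valid)
    (hf : ¬ p.Feasible) (hm : MeasurableSet {ω | rateST p h b ω < p.R0}) :
    outageProb p h g b P = 1 := by
  have hg0 := hp.gamma0_pos
  rw [outageProb, outageFirst, outageSecond]
  have hcompl : {ω | p.R0 ≤ rateST p h b ω} = {ω | rateST p h b ω < p.R0}ᶜ := by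
    ext ω; simp
  by_cases h1 : p.gamma0 * (p.rho * p.ISI) < 1
  · have h2 : p.alpha 0 ≤ p.gamma0 * p.alphaSec := not_lt.1 fun h2 => hf ⟨h1, h2⟩
    have hPR : ∀ ω, ratePR p h g b ω < p.R0 := by
      intro ω
      rw [ratePR_lt_iff hp]
      refine lt_of_le_of_lt (mul_nonpos_of_nonneg_of_nonpos (priGain_nonneg ω)
        (mul_nonpos_of_nonneg_of_nonpos (mul_nonneg hp.snr_pos.le (bestGain_nonneg ω))
          (mul_nonpos_of_nonneg_of_nonpos hp.rho_pos.le ?_))) hg0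
      linarith
    simp only [hPR, and_true]
    rw [hcompl, probReal_add_probReal_compl hm]
  · have hST : ∀ ω, rateST p h b ω < p.R0 := by
      intro ω
      rw [rateST_lt_iff hp]
      refine lt_of_le_of_lt (mul_nonpos_of_nonneg_of_nonpos (bestGain_nonneg ω)
        (mul_nonpos_of_nonneg_of_nonpos hp.snr_pos.le
          (mul_nonpos_of_nonneg_of_nonpos (sub_pos.2 hp.beta_lt_one).le ?_))) hg0
      rw [mul_assoc]
      linarith
    simp [hST, not_le.2 (hST _)]

end Thresholds

/-! ### Laws and independence of the best and the weakest gain -/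

section Law

variable {Ω : Type*} [MeasurableSpace Ω] {P : Measure Ω} {p : Params}
  {h : Fin p.K → Fin p.N → Ω → ℂ} {g : Fin (p.M + 1) → Ω → ℂ} {b : Ω → Fin p.K}

/-- The squared moduli of all channel coefficients. -/
def sqNorm (p : Params) (h : Fin p.K → Fin p.N → Ω → ℂ) (g : Fin (p.M + 1) → Ω → ℂ)
    (i : (Fin p.K × Fin p.N) ⊕ Fin (p.M + 1)) (ω : Ω) : ℝ :=
  ‖Sum.elim (fun kn : Fin p.K × Fin p.N => h kn.1 kn.2) g i ω‖ ^ 2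

theorem IsChannelModel.measurable_sqNorm (hm : IsChannelModel p P h g) (i) :
    Measurable (sqNorm p h g i) := by
  rcases i with i | i
  · exact (hm.rayleigh_h i.1 i.2).1.norm.pow_const 2
  · exact (hm.rayleigh_g i).1.norm.pow_const 2

theorem IsChannelModel.iIndepFun_sqNorm (hm : IsChannelModel p P h g) :
    iIndepFun (sqNorm p h g) P :=
  hm.indep.comp (fun _ z => ‖z‖ ^ 2) fun _ => measurable_norm.pow_const 2

theorem Params.Valid.univ_nonempty (hp : p.Valid) :
    (Finset.univ : Finset (Fin p.K)).Nonempty :=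
  ⟨⟨0, hp.one_le_K⟩, Finset.mem_univ _⟩

theorem measurable_finset_inf' {α ι : Type*} [MeasurableSpace α] {s : Finset ι}
    (hs : s.Nonempty) {f : ι → α → ℝ} (hf : ∀ i ∈ s, Measurable (f i)) :
    Measurable (s.inf' hs f) :=
  Finset.inf'_induction hs f (fun _ h₁ _ h₂ => h₁.inf h₂) hf

theorem IsChannelModel.measurable_bestGain (hm : IsChannelModel p P h g) (hp : p.Valid)
    (hb : IsBestST p h b) : Measurable (bestGain p h b) := by
  have : bestGain p h b = Finset.univ.sup' hp.univ_nonempty fun k => gainST p h k := by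
    ext ω
    rw [bestGain_eq_sup' hb hp.univ_nonempty, Finset.sup'_apply]
  rw [this]
  exact Finset.measurable_sup' _ fun k _ =>
    Finset.measurable_fun_sum _ fun n _ => hm.measurable_sqNorm (Sum.inl (k, n))

theorem IsChannelModel.measurable_priGain (hm : IsChannelModel p P h g) :
    Measurable (priGain p g) := by
  have : priGain p g = Finset.univ.inf' Finset.univ_nonempty fun i ω => ‖g i ω‖ ^ 2 := by
    ext ω
    rw [priGain, Finset.inf'_apply]
  rw [this]
  exact measurable_finset_inf' _ fun i _ => hm.measurable_sqNorm (Sum.inr i)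

theorem IsChannelModel.indepFun_bestGain_priGain (hm : IsChannelModel p P h g) (hp : p.Valid)
    (hb : IsBestST p h b) : IndepFun (bestGain p h b) (priGain p g) P := by
  let S : Finset ((Fin p.K × Fin p.N) ⊕ Fin (p.M + 1)) :=
    Finset.univ.map Function.Embedding.inl
  let T : Finset ((Fin p.K × Fin p.N) ⊕ Fin (p.M + 1)) :=
    Finset.univ.map Function.Embedding.inr
  have hST : Disjoint S T := by
    rw [Finset.disjoint_left]
    simp [S, T]
  have hI := hm.iIndepFun_sqNorm.indepFun_finset S T hST hm.measurable_sqNorm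
  let φ : (S → ℝ) → ℝ := Finset.univ.sup' hp.univ_nonempty
    fun (k : Fin p.K) (v : S → ℝ) => ∑ n, v ⟨Sum.inl (k, n), by simp [S]⟩
  let ψ : (T → ℝ) → ℝ := Finset.univ.inf' Finset.univ_nonempty
    fun (i : Fin (p.M + 1)) (v : T → ℝ) => v ⟨Sum.inr i, by simp [T]⟩
  have hφ : Measurable φ := Finset.measurable_sup' _ fun k _ => by fun_prop
  have hψ : Measurable ψ := measurable_finset_inf' _ fun i _ => by fun_prop
  convert! hI.comp hφ hψ using 1
  · ext ω
    simp only [φ, Function.comp_apply, Finset.sup'_apply]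
    exact bestGain_eq_sup' hb hp.univ_nonempty ω
  · ext ω
    simp only [ψ, Function.comp_apply, Finset.inf'_apply]
    rfl

variable [IsProbabilityMeasure P]

theorem IsChannelModel.real_bestGain_le (hm : IsChannelModel p P h g) (hp : p.Valid)
    (hb : IsBestST p h b) {x : ℝ} (hx : 0 ≤ x) :
    P.real {ω | bestGain p h b ω ≤ x} = p.gainCDF x := by
  have hmeas := hm.measurable_sqNorm
  have hind : iIndepFun (fun kn => sqNorm p h g (Sum.inl kn)) P :=
    hm.iIndepFun_sqNorm.precomp Sum.inl_injective
  have hset : {ω | bestGain p h b ω ≤ x} = {ω | ∀ k ∈ (Finset.univ : Finset (Fin p.K)),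
      ∑ n, sqNorm p h g (Sum.inl (k, n)) ω ≤ x} := by
    ext ω
    simpa only [Finset.mem_univ, forall_const] using! bestGain_le_iff hb ω x
  have hk : ∀ k : Fin p.K, P.real {ω | ∑ n, sqNorm p h g (Sum.inl (k, n)) ω ≤ x} =
      erlangCDF (1 / p.lamPS) p.N x := by
    intro k
    have := real_sum_exponential_le (P := P) (one_div_pos.2 hp.lamPS_pos)
      (E := fun n => sqNorm p h g (Sum.inl (k, n))) (fun n => hmeas _)
      (fun n ω => by unfold sqNorm; positivity)
      (hind.precomp (g := fun n : Fin p.N => (k, n)) (Prod.mk_right_injective k))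
      Finset.univ (fun n _ => (hm.rayleigh_h k n).2) hx
    simpa using this
  rw [hset, real_forall_sum_le (fun kn => hmeas _) hind, Params.gainCDF_eq_erlangCDF_pow hp]
  simp [hk]

theorem IsChannelModel.real_Iic_map_bestGain (hm : IsChannelModel p P h g) (hp : p.Valid)
    (hb : IsBestST p h b) (x : ℝ) (hx : 0 ≤ x) :
    (P.map (bestGain p h b)).real (Set.Iic x) = p.gainCDF x := by
  rw [map_measureReal_apply (hm.measurable_bestGain hp hb) measurableSet_Iic,
    ← hm.real_bestGain_le hp hb hx]
  rfl

theorem IsChannelModel.real_priGain_lt (hm : IsChannelModel p P h g) (hp : p.Valid)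
    {y : ℝ} (hy : 0 ≤ y) :
    P.real {ω | priGain p g ω < y} = p.orderCDF (fun t => Real.exp (-t)) 1 y := by
  have h1 := real_forall_le_exponential (P := P) (one_div_pos.2 hp.lamSP_pos)
    (E := fun i => sqNorm p h g (Sum.inr i)) (fun i => hm.measurable_sqNorm _)
    (hm.iIndepFun_sqNorm.precomp Sum.inr_injective) (fun i => (hm.rayleigh_g i).2) hy
  have hset : {ω | priGain p g ω < y} = {ω | ∀ i, y ≤ sqNorm p h g (Sum.inr i) ω}ᶜ := by
    ext ω
    simp [priGain, sqNorm, Finset.inf'_lt_iff]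
  have hmeas : MeasurableSet {ω | ∀ i, y ≤ sqNorm p h g (Sum.inr i) ω} := by
    have := hm.measurable_sqNorm
    have h2 : {ω | ∀ i, y ≤ sqNorm p h g (Sum.inr i) ω} =
        ⋂ i, {ω | y ≤ sqNorm p h g (Sum.inr i) ω} := by ext; simp
    rw [h2]
    exact MeasurableSet.iInter fun i => measurableSet_le measurable_const (this _)
  rw [hset, probReal_compl_eq_one_sub hmeas, h1, p.orderCDF_exp]
  simp only [Fintype.card_fin]
  push_cast
  ring_nf

end Law

/-! ### The outage terms as integrals against the density -/

section Outage

theorem one_sub_exp_neg_le (a : ℝ) : 1 - Real.exp (-a) ≤ a := by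
  have := Real.add_one_le_exp (-a)
  linarith

/-- Follows from `1 + a + a ^ 2 / 2 ≤ exp a` and `(1 - a + a ^ 2 / 2) * (1 + a + a ^ 2 / 2) = 1 + a
^ 4 / 4 ≥ 1`. -/
theorem sub_one_sub_exp_neg_le {a : ℝ} (ha : 0 ≤ a) : a - (1 - Real.exp (-a)) ≤ a ^ 2 / 2 := by
  have h1 := Real.quadratic_le_exp_of_nonneg ha
  have h2 : Real.exp (-a) * Real.exp a = 1 := by rw [← Real.exp_add]; simp
  have h3 : 0 < 1 + a + a ^ 2 / 2 := by positivity
  have h4 : Real.exp (-a) * (1 + a + a ^ 2 / 2) ≤ 1 :=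
    (mul_le_mul_of_nonneg_left h1 (Real.exp_pos _).le).trans h2.le
  have h5 : Real.exp (-a) * (1 + a + a ^ 2 / 2) ≤ (1 - a + a ^ 2 / 2) * (1 + a + a ^ 2 / 2) := by
    have : 0 ≤ a ^ 4 := by positivity
    nlinarith
  have := le_of_mul_le_mul_right h5 h3
  linarith

variable {Ω : Type*} [MeasurableSpace Ω] {P : Measure Ω} [IsProbabilityMeasure P] {p : Params}
  {h : Fin p.K → Fin p.N → Ω → ℂ} {g : Fin (p.M + 1) → Ω → ℂ} {b : Ω → Fin p.K}

theorem IsChannelModel.gainPDF_nonneg (hm : IsChannelModel p P h g) (hp : p.Valid)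
    (hb : IsBestST p h b) {x : ℝ} (hx : 0 < x) : 0 ≤ p.gainPDF x := by
  have := Measure.isProbabilityMeasure_map (μ := P) (hm.measurable_bestGain hp hb).aemeasurable
  exact density_nonneg_of_hasDerivAt (hm.real_Iic_map_bestGain hp hb) p.hasDerivAt_gainCDF hx

theorem IsChannelModel.integrableOn_gainPDF (hm : IsChannelModel p P h g) (hp : p.Valid)
    (hb : IsBestST p h b) {a : ℝ} (ha : 0 ≤ a) : IntegrableOn p.gainPDF (Set.Ioi a) := by
  have := Measure.isProbabilityMeasure_map (μ := P) (hm.measurable_bestGain hp hb).aemeasurable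
  exact (integrableOn_density (hm.real_Iic_map_bestGain hp hb) p.hasDerivAt_gainCDF
    (Params.tendsto_gainCDF hp)).mono_set (Set.Ioi_subset_Ioi ha)

theorem IsChannelModel.map_bestGain_singleton (hm : IsChannelModel p P h g) (hp : p.Valid)
    (hb : IsBestST p h b) {x : ℝ} (hx : 0 < x) : (P.map (bestGain p h b)) {x} = 0 := by
  have := Measure.isProbabilityMeasure_map (μ := P) (hm.measurable_bestGain hp hb).aemeasurable
  exact measure_singleton_eq_zero_of_hasDerivAt (hm.real_Iic_map_bestGain hp hb)
    p.hasDerivAt_gainCDF (Params.tendsto_gainCDF hp) hx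

theorem IsChannelModel.setIntegral_Ici_map_bestGain (hm : IsChannelModel p P h g) (hp : p.Valid)
    (hb : IsBestST p h b) {a : ℝ} (ha : 0 < a) (w : ℝ → ℝ) :
    ∫ x in Set.Ici a, w x ∂(P.map (bestGain p h b)) =
      ∫ x in Set.Ioi a, w x * p.gainPDF x := by
  have := Measure.isProbabilityMeasure_map (μ := P) (hm.measurable_bestGain hp hb).aemeasurable
  rw [← setIntegral_Ioi_eq_setIntegral_mul_density (hm.real_Iic_map_bestGain hp hb)
    p.hasDerivAt_gainCDF (Params.tendsto_gainCDF hp) ha.le w]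
  exact setIntegral_congr_set (Ioi_ae_eq_Ici' (hm.map_bestGain_singleton hp hb ha)).symm

/-- Outage is a strict inequality; it agrees with `≤` because the law of the best gain has no atom
at the positive threshold. -/
theorem IsChannelModel.outageFirst_eq (hm : IsChannelModel p P h g) (hp : p.Valid)
    (hb : IsBestST p h b) (hf : p.Feasible) :
    outageFirst p h b P = P.real {ω | bestGain p h b ω ≤ p.mu / p.snr} := by
  have hX := hm.measurable_bestGain hp hb
  have h1 : outageFirst p h b P =
      (P.map (bestGain p h b)).real (Set.Iio (p.mu / p.snr)) := by
    rw [map_measureReal_apply hX measurableSet_Iio, outageFirst]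
    congr 1
    ext ω
    exact rateST_lt_iff_of_feasible hp hf ω
  rw [h1, measureReal_congr (Iio_ae_eq_Iic'
    (hm.map_bestGain_singleton hp hb (div_pos (hp.mu_pos hf) hp.snr_pos))),
    map_measureReal_apply hX measurableSet_Iic]
  rfl

theorem IsChannelModel.outageSecond_eq (hm : IsChannelModel p P h g) (hp : p.Valid)
    (hb : IsBestST p h b) (hf : p.Feasible) :
    outageSecond p h g b P =
      ∫ x in Set.Ioi (p.mu / p.snr), p.condIntegrand (fun t => Real.exp (-t)) 1 x := by
  have ha : 0 < p.mu / p.snr := div_pos (hp.mu_pos hf) hp.snr_pos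
  have hA : MeasurableSet {q : ℝ × ℝ | p.mu / p.snr ≤ q.1 ∧ q.2 < p.theta0 / (p.snr * q.1)} := by
    rw [Set.ofPred_and]
    exact (measurableSet_le measurable_const measurable_fst).inter
      (measurableSet_lt measurable_snd (by fun_prop))
  have hset : {ω | p.R0 ≤ rateST p h b ω ∧ ratePR p h g b ω < p.R0} =
      {ω | (bestGain p h b ω, priGain p g ω) ∈
        {q : ℝ × ℝ | p.mu / p.snr ≤ q.1 ∧ q.2 < p.theta0 / (p.snr * q.1)}} := by
    ext ω
    simp only [Set.mem_ofPred_eq]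
    rw [← not_lt, rateST_lt_iff_of_feasible hp hf, not_lt]
    exact and_congr_right fun hX => ratePR_lt_iff_of_feasible hp hf (ha.trans_le hX)
  rw [outageSecond, hset, real_mem_eq_integral_of_indepFun (hm.measurable_bestGain hp hb)
    hm.measurable_priGain (hm.indepFun_bestGain_priGain hp hb) hA]
  have hind : ∀ x, P.real {ω | (x, priGain p g ω) ∈
      {q : ℝ × ℝ | p.mu / p.snr ≤ q.1 ∧ q.2 < p.theta0 / (p.snr * q.1)}} =
      (Set.Ici (p.mu / p.snr)).indicator (fun x => p.orderCDF (fun t => Real.exp (-t)) 1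
        (p.theta0 / (p.snr * x))) x := by
    intro x
    by_cases hx : p.mu / p.snr ≤ x
    · have hx0 := ha.trans_le hx
      rw [Set.indicator_of_mem (Set.mem_Ici.2 hx), ← hm.real_priGain_lt hp
        (div_nonneg (hp.theta0_pos hf).le (mul_nonneg hp.snr_pos.le hx0.le))]
      simp [hx]
    · rw [Set.indicator_of_notMem (by simpa using hx)]
      simp [hx]
  simp_rw [hind]
  rw [integral_indicator measurableSet_Ici, hm.setIntegral_Ici_map_bestGain hp hb ha]
  rfl

theorem IsChannelModel.integrableOn_condIntegrand_exp (hm : IsChannelModel p P h g) (hp : p.Valid)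
    (hb : IsBestST p h b) (hf : p.Feasible) :
    IntegrableOn (p.condIntegrand (fun t => Real.exp (-t)) 1) (Set.Ioi (p.mu / p.snr)) := by
  have ha : 0 < p.mu / p.snr := div_pos (hp.mu_pos hf) hp.snr_pos
  -- The bound `1` holds because the order-statistic factor is itself a probability.
  refine Integrable.bdd_mul (c := 1) (hm.integrableOn_gainPDF hp hb ha.le) ?_ ?_
  · simp_rw [p.orderCDF_exp]
    exact Measurable.aestronglyMeasurable (by fun_prop)
  · refine (ae_restrict_iff' measurableSet_Ioi).2 (Filter.Eventually.of_forall fun x hx => ?_)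
    have hx0 : 0 < x := ha.trans hx
    rw [← hm.real_priGain_lt hp (div_nonneg (hp.theta0_pos hf).le
      (mul_nonneg hp.snr_pos.le hx0.le)), Real.norm_of_nonneg measureReal_nonneg]
    exact measureReal_le_one

theorem IsChannelModel.setIntegral_bestGain (hm : IsChannelModel p P h g) (hp : p.Valid)
    (hb : IsBestST p h b) {a : ℝ} (ha : 0 < a) {w : ℝ → ℝ} (hw : Measurable w) :
    ∫ ω in {ω | a ≤ bestGain p h b ω}, w (bestGain p h b ω) ∂P =
      ∫ x in Set.Ioi a, w x * p.gainPDF x := by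
  rw [← hm.setIntegral_Ici_map_bestGain hp hb ha, setIntegral_map measurableSet_Ici
    hw.aestronglyMeasurable (hm.measurable_bestGain hp hb).aemeasurable]
  rfl

end Outage

end CoopNOMA

end

/-! ### Assembly and the error bound -/

theorem theorem1 {Ω : Type*} [MeasurableSpace Ω] (P : MeasureTheory.Measure Ω)
    [MeasureTheory.IsProbabilityMeasure P] (p : CoopNOMA.Params) (hp : p.Valid)
    (h : Fin p.K → Fin p.N → Ω → ℂ) (g : Fin (p.M + 1) → Ω → ℂ)
    (hmodel : CoopNOMA.IsChannelModel p P h g)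
    (b : Ω → Fin p.K) (hb : CoopNOMA.IsBestST p h b) :
    (p.Feasible →
      -- the first term is exact
      CoopNOMA.outageFirst p h b P
          = P.real {ω | CoopNOMA.bestGain p h b ω ≤ p.mu / p.snr} ∧
      CoopNOMA.outageFirst p h b P = p.gainCDF (p.mu / p.snr) ∧
      -- the exact conditioning integral for the second term
      MeasureTheory.IntegrableOn (p.condIntegrand (fun t => Real.exp (-t)) 1)
        (Set.Ioi (p.mu / p.snr)) ∧
      CoopNOMA.outageSecond p h g b P
          = ∫ x in Set.Ioi (p.mu / p.snr), p.condIntegrand (fun t => Real.exp (-t)) 1 x ∧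
      -- replacing `exp (-t)` by `1 - t` in that integral gives the incomplete gamma sum
      MeasureTheory.IntegrableOn (p.condIntegrand (fun t => 1 - t) 1)
        (Set.Ioi (p.mu / p.snr)) ∧
      ∫ x in Set.Ioi (p.mu / p.snr), p.condIntegrand (fun t => 1 - t) 1 x = p.gammaSum 1 ∧
      -- the resulting error
      CoopNOMA.outageProb p h g b P ≤ p.outageApprox ∧
      p.outageApprox - CoopNOMA.outageProb p h g b P
          ≤ (((p.M : ℝ) + 1) * p.theta0 / (p.lamSP * p.snr)) ^ 2 / 2 *
            ∫ ω in {ω | p.mu / p.snr ≤ CoopNOMA.bestGain p h b ω},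
              1 / (CoopNOMA.bestGain p h b ω) ^ 2 ∂P) ∧
    (¬ p.Feasible → CoopNOMA.outageProb p h g b P = 1) := by
  have hX := hmodel.measurable_bestGain hp hb
  refine ⟨fun hf => ?_, fun hf => CoopNOMA.outageProb_of_not_feasible P hp hf ?_⟩
  · have ha : 0 < p.mu / p.snr := div_pos (hp.mu_pos hf) hp.snr_pos
    have h1 := hmodel.outageFirst_eq hp hb hf
    have h2 := h1.trans (hmodel.real_bestGain_le hp hb ha.le)
    have h3 := hmodel.integrableOn_condIntegrand_exp hp hb hf
    have h4 := hmodel.outageSecond_eq hp hb hf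
    obtain ⟨h5, h6⟩ := CoopNOMA.Params.integrableOn_and_integral_condIntegrand_linear hp
      (hp.mu_pos hf)
    have hdiff : p.outageApprox - CoopNOMA.outageProb p h g b P =
        ∫ x in Set.Ioi (p.mu / p.snr), (p.condIntegrand (fun t => 1 - t) 1 x -
          p.condIntegrand (fun t => Real.exp (-t)) 1 x) := by
      rw [MeasureTheory.integral_sub h5 h3, h6, ← h4, CoopNOMA.Params.outageApprox,
        CoopNOMA.outageProb, h2]
      ring
    have hpt : ∀ x, p.condIntegrand (fun t => 1 - t) 1 x -
        p.condIntegrand (fun t => Real.exp (-t)) 1 x =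
        (((p.M : ℝ) + 1) * p.theta0 / (p.lamSP * p.snr) / x -
          (1 - Real.exp (-(((p.M : ℝ) + 1) * p.theta0 / (p.lamSP * p.snr) / x)))) *
            p.gainPDF x := by
      intro x
      rw [CoopNOMA.Params.condIntegrand, CoopNOMA.Params.condIntegrand, p.orderCDF_exp,
        p.orderCDF_linear, ← sub_mul, show ((p.M : ℝ) + 1) * (p.theta0 / (p.snr * x)) / p.lamSP =
          ((p.M : ℝ) + 1) * p.theta0 / (p.lamSP * p.snr) / x by
            simp only [div_eq_mul_inv, mul_inv]; ring]
    have hA : 0 ≤ ((p.M : ℝ) + 1) * p.theta0 / (p.lamSP * p.snr) := by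
      have := hp.theta0_pos hf
      have := hp.lamSP_pos
      have := hp.snr_pos
      positivity
    refine ⟨h1, h2, h3, h4, h5, h6, ?_, ?_⟩
    · rw [← sub_nonneg, hdiff]
      refine MeasureTheory.setIntegral_nonneg measurableSet_Ioi fun x hx => ?_
      rw [hpt]
      exact mul_nonneg (sub_nonneg.2 (CoopNOMA.one_sub_exp_neg_le _))
        (hmodel.gainPDF_nonneg hp hb (ha.trans hx))
    · rw [hdiff, hmodel.setIntegral_bestGain hp hb ha (w := fun x => 1 / x ^ 2) (by fun_prop),
        ← MeasureTheory.integral_const_mul]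
      -- The majorant is integrable since `1 / x ^ 2` is bounded by its value at the left endpoint
      -- `μ / snr > 0`.
      refine MeasureTheory.setIntegral_mono_on (h5.sub h3) (MeasureTheory.Integrable.const_mul
        (MeasureTheory.Integrable.bdd_mul (c := 1 / (p.mu / p.snr) ^ 2)
          (hmodel.integrableOn_gainPDF hp hb ha.le)
          (Measurable.aestronglyMeasurable (by fun_prop)) ?_) _) measurableSet_Ioi fun x hx => ?_
      · refine (MeasureTheory.ae_restrict_iff' measurableSet_Ioi).2
          (Filter.Eventually.of_forall fun x hx => ?_)
        have hx' : p.mu / p.snr ≤ x := le_of_lt hx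
        rw [Real.norm_of_nonneg (by positivity)]
        gcongr
      · have hx0 : 0 < x := ha.trans hx
        rw [hpt, ← mul_assoc]
        refine mul_le_mul_of_nonneg_right ((CoopNOMA.sub_one_sub_exp_neg_le
          (div_nonneg hA hx0.le)).trans_eq ?_) (hmodel.gainPDF_nonneg hp hb hx0)
        rw [div_pow]
        ring
  · simp_rw [CoopNOMA.rateST_lt_iff hp]
    exact measurableSet_lt (hX.mul_const _) measurable_const
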